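/- All graphs are finite and simple. The total graph $\mathcal T(G)$ of a graph $G$ has as vertices the vertices and the edges of $G$, two of them being adjacent if and only if the corresponding elements of $G$ are adjacent (two adjacent vertices, or two distinct edges with a common end vertex) or incident (a vertex and an edge having it as an end vertex). Put $\mathcal T^0(G)=G$ and $\mathcal T^{k+1}(G)=\mathcal T(\mathcal T^{k}(G))$ for $k\ge 0$. The incidence energy $IE(G)$ is the sum of the singular values of the vertex–edge incidence matrix of $G$ (the $0$–$1$ matrix with rows indexed by vertices and columns by edges, whose entry at $(v,e)$ is $1$ exactly when $v$ is an end vertex of $e$). Let $G$ be a nonempty regular graph of degree $r_0\ge 1$, and let $k\ge 0$ be an integer. Then $\mathcal T^k(G)$ is regular, and, writing $n_k$ and $r_k$ for its order and degree, $$IE(\mathcal T^{k+1}(G))<\frac{n_k(r_k-2)\sqrt{2r_k-2}}{2}+2n_k\sqrt{r_k}+(n_k-1)\sqrt{3r_k-2}$$ and $$IE(\mathcal T^{k+1}(G))\ge\frac{n_k(r_k-2)\sqrt{2r_k-2}}{2}+(n_k+1)\sqrt{r_k}+\sqrt{3r_k-2}+(n_k-1)\sqrt{2r_k-2}.$$ Equality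 holds in the second inequality if and only if $G\cong K_2$ and $k=0$. -/

import Mathlib

universe u

namespace SimpleGraph

/-- The total graph of `G`: its vertices are the vertices and the edges of `G`, and two of them are
adjacent iff the corresponding elements of `G` are adjacent (two adjacent vertices, or two distinct
edges with a common end vertex) or incident (a vertex and an edge containing it). -/
def totalGraph {V : Type u} (G : SimpleGraph V) : SimpleGraph (V ⊕ G.edgeSet) where
  Adj
    | .inl v, .inl w => G.Adj v w
    | .inl v, .inr e => v ∈ (e : Sym2 V)
    | .inr e, .inl v => v ∈ (e : Sym2 V)
    | .inr e, .inr f => G.lineGraph.Adj e f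
  symm := ⟨by
    rintro (v | e) (w | f) h
    · exact G.adj_symm h
    · exact h
    · exact h
    · exact G.lineGraph.adj_symm h⟩
  loopless := ⟨by
    rintro (v | e) h
    · exact G.irrefl h
    · exact G.lineGraph.irrefl h⟩

/-- The `k`-th iterated total graph bundled with its vertex type: `T^0(G) = G` and
`T^(k+1)(G) = T(T^k(G))`. -/
def totalIter {V : Type u} (G : SimpleGraph V) : ℕ → (Σ W : Type u, SimpleGraph W)
  | 0 => ⟨V, G⟩
  | k + 1 => ⟨(totalIter G k).1 ⊕ (totalIter G k).2.edgeSet, (totalIter G k).2.totalGraph⟩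

/-- The vertex type of the `k`-th iterated total graph. -/
abbrev TotalIterVert {V : Type u} (G : SimpleGraph V) (k : ℕ) : Type u := (G.totalIter k).1

/-- The `k`-th iterated total graph `T^k(G)`. -/
abbrev iteratedTotalGraph {V : Type u} (G : SimpleGraph V) (k : ℕ) :
    SimpleGraph (G.TotalIterVert k) := (G.totalIter k).2

instance finite_totalIterVert {V : Type u} [Finite V] (G : SimpleGraph V) (k : ℕ) :
    Finite (G.TotalIterVert k) := by
  induction k with
  | zero => exact ‹Finite V›
  | succ k ih =>
    change Finite (G.TotalIterVert k ⊕ (G.iteratedTotalGraph k).edgeSet)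
    infer_instance

noncomputable instance fintypeTotalIterVert {V : Type u} [Finite V] (G : SimpleGraph V) (k : ℕ) :
    Fintype (G.TotalIterVert k) := Fintype.ofFinite _

open Classical in
/-- The vertex-edge incidence matrix of `G`: rows are indexed by the vertices, columns by the edges,
and the entry at `(v, e)` is `1` if `v` is incident to `e` and `0` otherwise. -/
noncomputable def vertexEdgeMatrix {V : Type u} (G : SimpleGraph V) : Matrix V G.edgeSet ℝ :=
  (G.incMatrix ℝ).submatrix id Subtype.val

open Classical in
/-- The incidence energy of `G`: the sum of the singular values of its incidence matrix. -/
noncomputable def incidenceEnergy {V : Type u} [Fintype V] (G : SimpleGraph V) : ℝ :=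
  (Matrix.toEuclideanLin G.vertexEdgeMatrix).singularValues.sum fun _ s => s

end SimpleGraph

/-! The incidence energy is the sum of the square roots of the eigenvalues of the signless Laplacian
`B * Bᵀ`. For an `r`-regular graph of order `n`, block elimination shows that each signless
eigenvalue `q` gives the total graph two eigenvalues `totalRoot r (±1) q`, all others being `2r -
2`. So the energy of the total graph is the common first term of both bounds plus `∑ f(q)`, with `f
= totalContribution r`.

Lower bound: `f(q) > f(0)` for `q > 0`, and one eigenvalue is `2r`. Equality forces all others to
vanish, so the trace `n r` is `2r` and `n = 2`.

Upper bound: the target is `n f(2r) - √(3r-2)`. By `le_mul_totalContribution_sub`, `f(2r) - f(q)` is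
at least a fixed multiple of `2r - q`; these gaps add up to `n r`, and `n ≥ r + 1` makes the total
loss exceed `√(3r-2)`. -/

open Polynomial in
/-- The sum of the square roots of the real roots of `p`, counted with multiplicity. -/
noncomputable def Polynomial.sqrtRootSum (p : ℝ[X]) : ℝ := (p.roots.map Real.sqrt).sum

/-! ### Sums of square roots of roots -/

namespace Polynomial

theorem sqrtRootSum_mul {p q : ℝ[X]} (hp : p ≠ 0) (hq : q ≠ 0) :
    (p * q).sqrtRootSum = p.sqrtRootSum + q.sqrtRootSum := by
  simp [sqrtRootSum, roots_mul (mul_ne_zero hp hq)]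

theorem sqrtRootSum_X_sub_C_pow (a : ℝ) (n : ℕ) :
    ((X - C a) ^ n).sqrtRootSum = n * √a := by
  simp [sqrtRootSum, roots_pow, Multiset.map_nsmul, Multiset.sum_nsmul]

theorem sqrtRootSum_prod {ι : Type*} [Fintype ι] (f g : ι → ℝ) :
    (∏ i, ((X - C (f i)) * (X - C (g i)))).sqrtRootSum = ∑ i, (√(f i) + √(g i)) := by
  have h (f : ι → ℝ) : (∏ i, (X - C (f i))).sqrtRootSum = ∑ i, √(f i) := by
    rw [sqrtRootSum, roots_prod _ _ (Finset.prod_ne_zero_iff.2 fun i _ => X_sub_C_ne_zero _)]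
    simp [Multiset.bind_singleton]
  rw [Finset.prod_mul_distrib, sqrtRootSum_mul, h, h, Finset.sum_add_distrib] <;>
  exact Finset.prod_ne_zero_iff.2 fun i _ => X_sub_C_ne_zero _

end Polynomial

namespace Matrix

open Polynomial

/-- The two characteristic polynomials differ by powers of `X`, and the root `0` contributes
nothing. -/
theorem sqrtRootSum_charpoly_mul_comm {m n : Type*} [Fintype m] [Fintype n] [DecidableEq m]
    [DecidableEq n] (A : Matrix m n ℝ) (B : Matrix n m ℝ) :
    (A * B).charpoly.sqrtRootSum = (B * A).charpoly.sqrtRootSum := by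
  have h := congrArg sqrtRootSum (charpoly_mul_comm' A B)
  have hX (k : ℕ) : (X ^ k : ℝ[X]).sqrtRootSum = 0 := by
    simpa using sqrtRootSum_X_sub_C_pow 0 k
  rw [sqrtRootSum_mul (pow_ne_zero _ X_ne_zero) (charpoly_monic _).ne_zero,
    sqrtRootSum_mul (pow_ne_zero _ X_ne_zero) (charpoly_monic _).ne_zero, hX, hX] at h
  simpa using h

theorem sum_singularValues {m n : Type*} [Fintype m] [Fintype n] [DecidableEq m]
    [DecidableEq n] (A : Matrix m n ℝ) :
    ((toEuclideanLin A).singularValues.sum fun _ s => s) =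
      (Aᵀ * A).charpoly.sqrtRootSum := by
  set T := toEuclideanLin A
  have hN : Module.finrank ℝ (EuclideanSpace ℝ n) = Fintype.card n := by simp
  have hT : (LinearMap.adjoint T ∘ₗ T).charpoly = (Aᵀ * A).charpoly := by
    have : LinearMap.adjoint T ∘ₗ T = toEuclideanLin (Aᵀ * A) := by
      rw [← Matrix.toEuclideanLin_conjTranspose_eq_adjoint]
      simp [T, Matrix.toLpLin_mul_same]
    rw [this]
    rw [← charpoly_toLin _ (PiLp.basisFun 2 ℝ n), ← toLpLin_eq_toLin 2 2]
  rw [← hT, Finsupp.sum_of_support_subset (s := Finset.range (Fintype.card n)), sqrtRootSum,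
    T.isSymmetric_adjoint_comp_self.roots_charpoly_eq_eigenvalues hN, ← Fin.sum_univ_eq_sum_range]
  · simp [T.singularValues_fin hN, List.sum_ofFn]
  · intro i hi
    rw [Finset.mem_range]
    by_contra h
    exact Finsupp.mem_support_iff.1 hi (T.singularValues_of_finrank_le (by omega))
  · simp

end Matrix

/-! ### Incidence matrices and line graphs -/

namespace SimpleGraph

open Matrix Classical

variable {V : Type*} (G : SimpleGraph V)

theorem vertexEdgeMatrix_apply (v : V) (e : G.edgeSet) :
    G.vertexEdgeMatrix v e = if v ∈ (e : Sym2 V) then 1 else 0 := by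
  simp [vertexEdgeMatrix, incMatrix_apply', incidenceSet, e.2]

theorem adjMatrix_totalGraph :
    G.totalGraph.adjMatrix ℝ = fromBlocks (G.adjMatrix ℝ) G.vertexEdgeMatrix G.vertexEdgeMatrixᵀ
      (G.lineGraph.adjMatrix ℝ) := by
  ext (v | e) (w | f) <;> simp only [adjMatrix_apply, vertexEdgeMatrix_apply, fromBlocks_apply₁₁,
    fromBlocks_apply₁₂, fromBlocks_apply₂₁, fromBlocks_apply₂₂, transpose_apply]
  exacts [if_congr Iff.rfl rfl rfl, if_congr Iff.rfl rfl rfl, if_congr Iff.rfl rfl rfl,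
    if_congr Iff.rfl rfl rfl]

variable [Fintype V]

theorem incidenceEnergy_eq_sqrtRootSum :
    G.incidenceEnergy = (G.vertexEdgeMatrix * G.vertexEdgeMatrixᵀ).charpoly.sqrtRootSum := by
  rw [sqrtRootSum_charpoly_mul_comm]
  exact sum_singularValues _

theorem sum_edgeSet_eq_sum_sym2 {f : Sym2 V → ℝ} (hf : ∀ e ∉ G.edgeSet, f e = 0) :
    ∑ e : G.edgeSet, f e = ∑ e, f e := by
  rw [← Finset.sum_subtype G.edgeFinset (fun _ => mem_edgeFinset) f]
  exact Finset.sum_subset (Finset.subset_univ _) fun e _ he => hf e (by simpa using he)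

theorem vertexEdgeMatrix_mul_transpose :
    G.vertexEdgeMatrix * G.vertexEdgeMatrixᵀ = G.degMatrix ℝ + G.adjMatrix ℝ := by
  have h : G.vertexEdgeMatrix * G.vertexEdgeMatrixᵀ = G.incMatrix ℝ * (G.incMatrix ℝ)ᵀ := by
    ext v w
    refine G.sum_edgeSet_eq_sum_sym2 (f := fun e => G.incMatrix ℝ v e * G.incMatrix ℝ w e)
      fun e he => ?_
    simp [incMatrix_apply', incidenceSet, he]
  rw [h, incMatrix_mul_transpose]
  ext v w
  by_cases hvw : v = w <;> simp [degMatrix, hvw]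

theorem sum_vertexEdgeMatrix_row (v : V) : ∑ e, G.vertexEdgeMatrix v e = G.degree v := by
  rw [← G.sum_incMatrix_apply (R := ℝ)]
  exact G.sum_edgeSet_eq_sum_sym2 (f := fun e => G.incMatrix ℝ v e) fun e he => by simp [incMatrix_apply', incidenceSet, he]

theorem sum_vertexEdgeMatrix_col (e : G.edgeSet) : ∑ v, G.vertexEdgeMatrix v e = 2 := by
  simpa [vertexEdgeMatrix] using G.sum_incMatrix_apply_of_mem_edgeSet (R := ℝ) e.2

/-- Distinct edges share at most one vertex, so off-diagonal entries are `0` or `1`. -/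
theorem transpose_mul_vertexEdgeMatrix :
    G.vertexEdgeMatrixᵀ * G.vertexEdgeMatrix = G.lineGraph.adjMatrix ℝ + (2 : ℝ) • 1 := by
  ext e f
  by_cases hef : e = f
  · subst hef
    have := G.sum_vertexEdgeMatrix_col e
    simp only [mul_apply, transpose_apply, vertexEdgeMatrix_apply, mul_ite, mul_one, mul_zero]
    simpa [← ite_and, vertexEdgeMatrix_apply] using this
  · have hcard : (∑ v, if v ∈ (e : Sym2 V) ∧ v ∈ (f : Sym2 V) then (1 : ℝ) else 0) =
        if G.lineGraph.Adj e f then 1 else 0 := by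
      split_ifs with h
      · obtain ⟨-, v, hv⟩ := G.lineGraph_adj_iff_exists.1 h
        rw [Finset.sum_eq_single v, if_pos hv]
        · intro w _ hw
          rw [if_neg]
          rintro ⟨h1, h2⟩
          exact hef (Subtype.ext (Sym2.eq_of_ne_mem hw h1 hv.1 h2 hv.2))
        · simp
      · refine Finset.sum_eq_zero fun v _ => if_neg fun hv => h ?_
        exact G.lineGraph_adj_iff_exists.2 ⟨hef, v, hv⟩
    simp [mul_apply, vertexEdgeMatrix_apply, hef, ← ite_and]
    simpa [and_comm, one_apply, hef] using hcard

end SimpleGraph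

/-- For `s = 1` and `s = -1`, the two eigenvalues of the signless Laplacian of the total graph of an
`r`-regular graph that come from an eigenvalue `q` of the signless Laplacian of the graph. -/
noncomputable def totalRoot (r s q : ℝ) : ℝ :=
  (2 * q + 3 * r - 2 + s * √(4 * q + (r - 2) ^ 2)) / 2

/-! ### Spectrum of the total graph's block matrix -/

namespace Matrix

open Polynomial

variable {m n : Type*} [Fintype m] [Fintype n] [DecidableEq m] [DecidableEq n]

theorem IsHermitian.det_quadratic {S : Matrix n n ℝ} (hS : S.IsHermitian) (a b : ℝ) :
    (S * S + a • S + b • (1 : Matrix n n ℝ)).det =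
      ∏ i, (hS.eigenvalues i ^ 2 + a * hS.eigenvalues i + b) := by
  set U : Matrix n n ℝ := (hS.eigenvectorUnitary : Matrix n n ℝ)
  set D : Matrix n n ℝ := diagonal hS.eigenvalues
  have hU : star U * U = 1 := by simp [U]
  have hU' : U * star U = 1 := by simp [U]
  have hSU : S = U * D * star U := by
    simpa [Unitary.conjStarAlgAut_apply, Function.comp_def] using hS.spectral_theorem
  have hconj : S * S + a • S + b • (1 : Matrix n n ℝ) =
      U * (D * D + a • D + b • (1 : Matrix n n ℝ)) * star U := by
    have h2 : S * S = U * (D * D) * star U := by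
      calc S * S = U * D * (star U * U) * D * star U := by
            rw [hSU]; simp only [Matrix.mul_assoc]
        _ = _ := by rw [hU]; simp only [Matrix.mul_assoc, Matrix.one_mul]
    rw [h2]
    simp only [Matrix.mul_add, Matrix.add_mul, Matrix.mul_smul, Matrix.smul_mul, Matrix.mul_one,
      hU', ← hSU]
  rw [hconj, det_mul_right_comm, hU', Matrix.one_mul]
  have hD : D * D + a • D + b • (1 : Matrix n n ℝ) =
      diagonal fun i => hS.eigenvalues i ^ 2 + a * hS.eigenvalues i + b := by
    ext i j
    by_cases h : i = j
    · subst h; simp [D, sq]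
    · simp [D, h]
  rw [hD, det_diagonal]

/-- The characteristic determinant of the signless Laplacian of a total graph, in terms of the
incidence matrix of the base graph. -/
theorem pow_mul_det_fromBlocks_incidence (B : Matrix n m ℝ) (a c : ℝ) :
    c ^ Fintype.card n * (fromBlocks (a • 1 - B * Bᵀ) (-B) (-Bᵀ) (c • 1 - Bᵀ * B)).det =
      c ^ Fintype.card m *
        (B * Bᵀ * (B * Bᵀ) + (-(a + 1 + c)) • (B * Bᵀ) + (c * a) • (1 : Matrix n n ℝ)).det := by
  set S := B * Bᵀ
  -- Elimination without inverting `c`: the row operation makes the lower right block `c • 1`, and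
  -- scaling the first block column by `c` lets the second one clear the lower left block.
  have h : fromBlocks 1 0 (-Bᵀ) (1 : Matrix m m ℝ) *
      fromBlocks (a • 1 - S) (-B) (-Bᵀ) (c • 1 - Bᵀ * B) *
      fromBlocks (c • (1 : Matrix n n ℝ)) 0 (-(Bᵀ * S - (a + 1) • Bᵀ)) 1 =
      fromBlocks (S * S + (-(a + 1 + c)) • S + (c * a) • 1) (-B) 0 (c • 1) := by
    have hBS : B * (Bᵀ * S) = S * S := by rw [← Matrix.mul_assoc]
    simp only [fromBlocks_multiply]
    congr 1
    · simp [Matrix.mul_sub, hBS, show B * Bᵀ = S from rfl]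
      module
    · simp
    · simp [Matrix.mul_sub]
      module
    · simp
  have h' := congrArg det h
  rw [det_mul, det_mul, det_fromBlocks_zero₁₂, det_fromBlocks_zero₁₂, det_fromBlocks_zero₂₁] at h'
  simp only [det_one, det_smul, mul_one, one_mul] at h'
  linarith

theorem sqrtRootSum_charpoly_total (B : Matrix n m ℝ) (r : ℝ)
    (hS : (B * Bᵀ).IsHermitian) (hpos : ∀ i, 0 ≤ hS.eigenvalues i) :
    (fromBlocks (r • 1 + B * Bᵀ) B Bᵀ ((2 * r - 2) • 1 + Bᵀ * B)).charpoly.sqrtRootSum +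
        Fintype.card n * √(2 * r - 2) =
      Fintype.card m * √(2 * r - 2) + ∑ i, (√(totalRoot r 1 (hS.eigenvalues i)) +
        √(totalRoot r (-1) (hS.eigenvalues i))) := by
  set M := fromBlocks (r • 1 + B * Bᵀ) B Bᵀ ((2 * r - 2) • 1 + Bᵀ * B)
  -- The factor stays on the left because `m` may be smaller than `n`, as for 1-regular graphs.
  have key : M.charpoly * (X - C (2 * r - 2)) ^ Fintype.card n =
      (X - C (2 * r - 2)) ^ Fintype.card m *
        ∏ i, ((X - C (totalRoot r 1 (hS.eigenvalues i))) *
          (X - C (totalRoot r (-1) (hS.eigenvalues i)))) := by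
    refine Polynomial.funext fun x => ?_
    have h := pow_mul_det_fromBlocks_incidence B (x - r) (x - (2 * r - 2))
    rw [hS.det_quadratic] at h
    have hM : (scalar (n ⊕ m) x - M) = fromBlocks ((x - r) • 1 - B * Bᵀ) (-B) (-Bᵀ)
        ((x - (2 * r - 2)) • 1 - Bᵀ * B) := by
      ext (i | i) (j | j) <;> simp [M, diagonal_apply, one_apply] <;> split_ifs <;> ring
    rw [eval_mul, eval_charpoly, hM]
    simp only [eval_mul, eval_pow, eval_sub, eval_X, eval_C, eval_prod]
    rw [mul_comm, h]
    congr 1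
    refine Finset.prod_congr rfl fun i _ => ?_
    have hs := Real.sq_sqrt (show 0 ≤ 4 * hS.eigenvalues i + (r - 2) ^ 2 by
      linarith [hpos i, sq_nonneg (r - 2)])
    simp only [totalRoot]
    linear_combination (1 / 4 : ℝ) * hs
  have h := congrArg sqrtRootSum key
  have h1 (k : ℕ) : (X - C (2 * r - 2)) ^ k ≠ 0 := pow_ne_zero _ (X_sub_C_ne_zero _)
  rw [sqrtRootSum_mul (charpoly_monic _).ne_zero (h1 _), sqrtRootSum_mul (h1 _)
    (Finset.prod_ne_zero_iff.2 fun i _ => mul_ne_zero (X_sub_C_ne_zero _) (X_sub_C_ne_zero _)),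
    sqrtRootSum_prod, sqrtRootSum_X_sub_C_pow, sqrtRootSum_X_sub_C_pow] at h
  exact h

end Matrix

/-- The contribution of an eigenvalue `q` of the signless Laplacian of an `r`-regular graph to the
incidence energy of its total graph. -/
noncomputable def totalContribution (r q : ℝ) : ℝ :=
  √(totalRoot r 1 q) + √(totalRoot r (-1) q)

/-! ### Estimates for the contribution of one eigenvalue -/

section totalContribution

variable {r q : ℝ}

theorem totalContribution_nonneg : 0 ≤ totalContribution r q := by
  unfold totalContribution; positivity

theorem totalContribution_sq (hr : 1 ≤ r) (hq : 0 ≤ q) :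
    totalContribution r q ^ 2 =
      2 * q + 3 * r - 2 + 2 * √(q ^ 2 + 3 * (r - 1) * q + 2 * r * (r - 1)) := by
  have hd : 0 ≤ 4 * q + (r - 2) ^ 2 := by positivity
  have hs := Real.sq_sqrt hd
  have hs0 := Real.sqrt_nonneg (4 * q + (r - 2) ^ 2)
  have hP : 0 ≤ q ^ 2 + 3 * (r - 1) * q + 2 * r * (r - 1) := by
    have : 0 ≤ r - 1 := by linarith
    positivity
  -- The difference of the squares is four times the quantity in `hP`.
  have hle : √(4 * q + (r - 2) ^ 2) ≤ 2 * q + 3 * r - 2 := by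
    refine Real.sqrt_le_iff.2 ⟨by linarith, ?_⟩
    linarith
  have h1 : 0 ≤ totalRoot r 1 q := by unfold totalRoot; linarith
  have h2 : 0 ≤ totalRoot r (-1) q := by unfold totalRoot; linarith
  have hprod : totalRoot r 1 q * totalRoot r (-1) q =
      q ^ 2 + 3 * (r - 1) * q + 2 * r * (r - 1) := by
    unfold totalRoot
    linear_combination (-1 / 4 : ℝ) * hs
  rw [totalContribution, add_sq, Real.sq_sqrt h1, Real.sq_sqrt h2, mul_assoc, ← Real.sqrt_mul h1,
    hprod]
  unfold totalRoot
  ring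

theorem totalContribution_zero (hr : 1 ≤ r) :
    totalContribution r 0 = √r + √(2 * r - 2) := by
  rw [← sq_eq_sq₀ totalContribution_nonneg (by positivity), totalContribution_sq hr le_rfl, add_sq,
    Real.sq_sqrt (by linarith), Real.sq_sqrt (by linarith), mul_assoc (2 : ℝ) √r,
    ← Real.sqrt_mul (by linarith)]
  ring_nf

theorem totalContribution_two_mul (hr : 1 ≤ r) :
    totalContribution r (2 * r) = 2 * √r + √(3 * r - 2) := by
  have h : √((2 * r) ^ 2 + 3 * (r - 1) * (2 * r) + 2 * r * (r - 1)) = 2 * (√r * √(3 * r - 2)) := by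
    rw [show (2 * r) ^ 2 + 3 * (r - 1) * (2 * r) + 2 * r * (r - 1) = 2 ^ 2 * (r * (3 * r - 2)) by
      ring, Real.sqrt_mul (by norm_num), Real.sqrt_sq (by norm_num), Real.sqrt_mul (by linarith)]
  rw [← sq_eq_sq₀ totalContribution_nonneg (by positivity),
    totalContribution_sq hr (by linarith), h, add_sq, mul_pow, Real.sq_sqrt (by linarith),
    Real.sq_sqrt (by linarith)]
  ring

theorem totalContribution_zero_lt (hr : 1 ≤ r) (hq : 0 < q) :
    totalContribution r 0 < totalContribution r q := by
  refine lt_of_pow_lt_pow_left₀ 2 totalContribution_nonneg ?_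
  rw [totalContribution_sq hr le_rfl, totalContribution_sq hr hq.le]
  have h : √(0 ^ 2 + 3 * (r - 1) * 0 + 2 * r * (r - 1)) ≤
      √(q ^ 2 + 3 * (r - 1) * q + 2 * r * (r - 1)) := by
    refine Real.sqrt_le_sqrt ?_
    have : 0 ≤ r - 1 := by linarith
    have : 0 ≤ q ^ 2 + 3 * (r - 1) * q := by positivity
    linarith
  linarith

theorem totalContribution_zero_le (hr : 1 ≤ r) (hq : 0 ≤ q) :
    totalContribution r 0 ≤ totalContribution r q := by
  rcases hq.eq_or_lt with rfl | h
  · rfl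
  · exact (totalContribution_zero_lt hr h).le

theorem sqrt_mul_sqrt_le (hr : 1 ≤ r) : √r * √(3 * r - 2) ≤ 2 * r - 1 := by
  have := two_mul_le_add_sq √r √(3 * r - 2)
  rw [Real.sq_sqrt (by linarith), Real.sq_sqrt (by linarith)] at this
  linarith

/-- With `f = totalContribution r`, `2 f(2r) (f(2r) - f(q)) ≥ f(2r)² - f(q)²`. In the squares, the
linear part yields `2 (2r - q)` and the radical at least `3/2 (2r - q)`, hence the constant 7. -/
theorem le_mul_totalContribution_sub (hr : 1 ≤ r) (hq : 0 ≤ q) (hq' : q ≤ 2 * r) :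
    7 * (2 * r - q) ≤ 4 * totalContribution r (2 * r) *
      (totalContribution r (2 * r) - totalContribution r q) := by
  set s := √r * √(3 * r - 2)
  have hs := sqrt_mul_sqrt_le hr
  have hs2 : s ^ 2 = r * (3 * r - 2) := by
    rw [mul_pow, Real.sq_sqrt (by linarith), Real.sq_sqrt (by linarith)]
  have hs1 : r ≤ s := by
    refine le_of_sq_le_sq ?_ (by positivity)
    nlinarith
  have h := totalContribution_sq hr hq
  have h2 : totalContribution r (2 * r) ^ 2 = 7 * r - 2 + 4 * s := by
    rw [totalContribution_two_mul hr, add_sq, mul_pow, Real.sq_sqrt (by linarith),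
      Real.sq_sqrt (by linarith)]
    ring
  -- At `q = 2r` the radical equals `2 s`. With `t = 2r - q`, the squares differ by `t (7r - 3 - 3s
  -- - 7t/16)`, nonnegative since `s ≤ 2r - 1` and `t ≤ 2r`.
  have hP : √(q ^ 2 + 3 * (r - 1) * q + 2 * r * (r - 1)) ≤ 2 * s - 3 / 4 * (2 * r - q) := by
    refine Real.sqrt_le_iff.2 ⟨by linarith, ?_⟩
    nlinarith [mul_nonneg (sub_nonneg.2 hq') (sub_nonneg.2 hs), mul_nonneg (sub_nonneg.2 hq') hq,
      mul_nonneg (sub_nonneg.2 hq') (sub_nonneg.2 hr)]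
  nlinarith [sq_nonneg (totalContribution r (2 * r) - totalContribution r q)]

variable {ι : Type*} [Fintype ι] {q : ι → ℝ}

theorem sum_totalContribution_lt (hr : 1 ≤ r) (hn : r + 1 ≤ (Fintype.card ι : ℝ)) (hq : ∀ i, 0 ≤ q i)
    (hq' : ∀ i, q i ≤ 2 * r) (hsum : ∑ i, q i = Fintype.card ι * r) :
    ∑ i, totalContribution r (q i) <
      2 * (Fintype.card ι : ℝ) * √r + (Fintype.card ι - 1) * √(3 * r - 2) := by
  have h := Finset.sum_le_sum fun i (_ : i ∈ Finset.univ) =>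
    le_mul_totalContribution_sub hr (hq i) (hq' i)
  simp only [← Finset.mul_sum, Finset.sum_sub_distrib, hsum] at h
  simp only [Finset.sum_const, Finset.card_univ, nsmul_eq_mul] at h
  rw [totalContribution_two_mul hr] at h
  have hs := sqrt_mul_sqrt_le hr
  have h1 := Real.sq_sqrt (show 0 ≤ r by linarith)
  have h2 := Real.sq_sqrt (show 0 ≤ 3 * r - 2 by linarith)
  have h3 : 0 < √r := Real.sqrt_pos.2 (by linarith)
  have h4 : 0 < √(3 * r - 2) := Real.sqrt_pos.2 (by linarith)
  set N : ℝ := (Fintype.card ι : ℝ)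
  have hN : r * (r + 1) ≤ N * r := by nlinarith
  -- The left side is at most `7r - 4`, and `7r² - 21r + 16` has negative discriminant; the square
  -- hint completes it.
  have key : (2 * √r + √(3 * r - 2)) * √(3 * r - 2) < 7 / 4 * (N * r) := by
    nlinarith [sq_nonneg (14 * r - 21)]
  have : 0 < (2 * √r + √(3 * r - 2)) * (N * (2 * √r + √(3 * r - 2)) -
      ∑ i, totalContribution r (q i) - √(3 * r - 2)) := by
    nlinarith
  have := pos_of_mul_pos_right this (by positivity)
  linarith

theorem sum_totalContribution_lower {i₀ : ι} (hr : 1 ≤ r) (hq : ∀ i, 0 ≤ q i)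
    (hi₀ : q i₀ = 2 * r) :
    (Fintype.card ι + 1) * √r + √(3 * r - 2) + (Fintype.card ι - 1) * √(2 * r - 2) ≤
      ∑ i, totalContribution r (q i) ∧
    (∑ i, totalContribution r (q i) =
      (Fintype.card ι + 1) * √r + √(3 * r - 2) + (Fintype.card ι - 1) * √(2 * r - 2) ↔
      ∑ i, q i = 2 * r) := by
  classical
  have hrhs : (Fintype.card ι + 1) * √r + √(3 * r - 2) + (Fintype.card ι - 1) * √(2 * r - 2) =
      totalContribution r (q i₀) + ∑ i ∈ Finset.univ.erase i₀, totalContribution r 0 := by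
    have : 1 ≤ Fintype.card ι := Fintype.card_pos_iff.2 ⟨i₀⟩
    rw [Finset.sum_const, Finset.card_erase_of_mem (Finset.mem_univ _), hi₀, Finset.card_univ,
      totalContribution_two_mul hr, totalContribution_zero hr, nsmul_eq_mul, Nat.cast_sub this]
    push_cast
    ring
  have hle := fun i (_ : i ∈ Finset.univ.erase i₀) => totalContribution_zero_le hr (hq i)
  rw [hrhs, ← Finset.add_sum_erase _ _ (Finset.mem_univ i₀)]
  refine ⟨by gcongr with i hi; exact hle i hi, ?_⟩
  rw [add_right_inj, eq_comm, Finset.sum_eq_sum_iff_of_le hle,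
    ← Finset.add_sum_erase _ q (Finset.mem_univ i₀), hi₀, add_eq_left,
    Finset.sum_eq_zero_iff_of_nonneg fun i _ => hq i]
  refine forall₂_congr fun i _ => ⟨fun h => ?_, fun h => by rw [h]⟩
  by_contra h0
  exact (totalContribution_zero_lt hr ((hq i).lt_of_ne' h0)).ne h

end totalContribution

/-! ### Regular graphs and iterated total graphs -/

namespace SimpleGraph

open Matrix Classical

/-- Needed because iterated vertex types get their `Fintype` from finiteness, not from the sum type.
-/
theorem incidenceEnergy_congr_fintype {V : Type*} (G : SimpleGraph V) (i j : Fintype V) :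
    @incidenceEnergy V i G = @incidenceEnergy V j G := by
  congr!

theorem isRegularOfDegree_congr_locallyFinite {V : Type*} {G : SimpleGraph V} {d : ℕ}
    {i : G.LocallyFinite} (j : G.LocallyFinite) (h : @IsRegularOfDegree V G i d) :
    @IsRegularOfDegree V G j d := by
  convert h

variable {V : Type*} [Fintype V] {G : SimpleGraph V} {d : ℕ}

theorem sum_adjMatrix_row (G : SimpleGraph V) (v : V) : ∑ w, G.adjMatrix ℝ v w = G.degree v := by
  simp [adjMatrix_apply, ← card_neighborFinset_eq_degree, neighborFinset_eq_filter]

theorem IsRegularOfDegree.two_mul_card_edgeSet (hG : G.IsRegularOfDegree d) :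
    2 * Fintype.card G.edgeSet = Fintype.card V * d := by
  have := G.sum_degrees_eq_twice_card_edges
  simp only [hG.degree_eq, Finset.sum_const, Finset.card_univ, smul_eq_mul] at this
  rw [this, edgeFinset_card]

theorem IsRegularOfDegree.totalGraph (hG : G.IsRegularOfDegree d) :
    G.totalGraph.IsRegularOfDegree (2 * d) := by
  intro x
  rw [← Nat.cast_inj (R := ℝ), ← sum_adjMatrix_row, adjMatrix_totalGraph, Fintype.sum_sum_type]
  rcases x with v | e
  · simp only [fromBlocks_apply₁₁, fromBlocks_apply₁₂, sum_adjMatrix_row,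
      sum_vertexEdgeMatrix_row, hG.degree_eq]
    push_cast; ring
  · have h := G.transpose_mul_vertexEdgeMatrix
    -- Rows of `Bᵀ * B` sum to `2d`, since columns of `B` sum to `2` and rows to `d`.
    have hrow : ∑ f, G.lineGraph.adjMatrix ℝ e f = 2 * d - 2 := by
      rw [eq_sub_of_add_eq h.symm]
      simp only [Matrix.sub_apply, Finset.sum_sub_distrib, Matrix.mul_apply, transpose_apply]
      rw [Finset.sum_comm]
      simp only [← Finset.mul_sum, sum_vertexEdgeMatrix_row, hG.degree_eq, ← Finset.sum_mul,
        sum_vertexEdgeMatrix_col]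
      simp [Matrix.one_apply]
    simp only [fromBlocks_apply₂₁, fromBlocks_apply₂₂, transpose_apply, hrow,
      sum_vertexEdgeMatrix_col]
    push_cast; ring

theorem IsRegularOfDegree.vertexEdgeMatrix_mul_transpose (hG : G.IsRegularOfDegree d) :
    G.vertexEdgeMatrix * G.vertexEdgeMatrixᵀ = (d : ℝ) • 1 + G.adjMatrix ℝ := by
  rw [G.vertexEdgeMatrix_mul_transpose]
  congr 1
  ext v w
  by_cases h : v = w <;> simp [degMatrix, h, hG.degree_eq]

theorem posSemidef_vertexEdgeMatrix_mul_transpose (G : SimpleGraph V) :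
    (G.vertexEdgeMatrix * G.vertexEdgeMatrixᵀ).PosSemidef := by
  simpa [conjTranspose_eq_transpose_of_trivial] using
    posSemidef_self_mul_conjTranspose G.vertexEdgeMatrix

/-- The eigenvalues of the signless Laplacian `B * Bᵀ` of `G`. -/
noncomputable def signlessEigenvalues (G : SimpleGraph V) : V → ℝ :=
  G.posSemidef_vertexEdgeMatrix_mul_transpose.isHermitian.eigenvalues

theorem signlessEigenvalues_nonneg (v : V) : 0 ≤ G.signlessEigenvalues v :=
  G.posSemidef_vertexEdgeMatrix_mul_transpose.eigenvalues_nonneg v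

theorem IsRegularOfDegree.sum_signlessEigenvalues (hG : G.IsRegularOfDegree d) :
    ∑ v, G.signlessEigenvalues v = Fintype.card V * d := by
  have h := G.posSemidef_vertexEdgeMatrix_mul_transpose.isHermitian.trace_eq_sum_eigenvalues
  refine h.symm.trans ?_
  rw [hG.vertexEdgeMatrix_mul_transpose]
  simp [trace_add, trace_smul, mul_comm]

/-- For regular `G`, `2d - B * Bᵀ` is the Laplacian, which is positive semidefinite. -/
theorem IsRegularOfDegree.signlessEigenvalues_le (hG : G.IsRegularOfDegree d) (v : V) :
    G.signlessEigenvalues v ≤ 2 * d := by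
  have hS := G.posSemidef_vertexEdgeMatrix_mul_transpose.isHermitian
  have hlap : G.lapMatrix ℝ = (2 * d : ℝ) • 1 - G.vertexEdgeMatrix * G.vertexEdgeMatrixᵀ := by
    rw [hG.vertexEdgeMatrix_mul_transpose]
    ext v w
    by_cases h : v = w
    · simp [lapMatrix, degMatrix, h, hG.degree_eq]; ring
    · simp [lapMatrix, degMatrix, h]
  set x : V → ℝ := (hS.eigenvectorBasis v).ofLp
  have hx : (G.vertexEdgeMatrix * G.vertexEdgeMatrixᵀ) *ᵥ x = G.signlessEigenvalues v • x :=
    hS.mulVec_eigenvectorBasis v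
  have hx0 : 0 < x ⬝ᵥ x := by
    refine (Finset.sum_nonneg fun i _ => mul_self_nonneg (x i)).lt_of_ne' fun h => ?_
    refine (hS.eigenvectorBasis.toBasis.ne_zero v) ?_
    ext i
    simpa using congrFun (dotProduct_self_eq_zero.1 h) i
  have h := (posSemidef_lapMatrix ℝ G).dotProduct_mulVec_nonneg x
  rw [hlap, sub_mulVec, smul_mulVec, one_mulVec, hx, ← sub_smul, dotProduct_smul, star_trivial,
    smul_eq_mul] at h
  linarith [nonneg_of_mul_nonneg_left h hx0]

theorem IsRegularOfDegree.exists_signlessEigenvalues_eq [Nonempty V]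
    (hG : G.IsRegularOfDegree d) : ∃ v, G.signlessEigenvalues v = 2 * d := by
  have hS := G.posSemidef_vertexEdgeMatrix_mul_transpose.isHermitian
  have h : (2 * d : ℝ) ∈ spectrum ℝ (G.vertexEdgeMatrix * G.vertexEdgeMatrixᵀ) := by
    rw [spectrum.mem_iff, isUnit_iff_isUnit_det, isUnit_iff_ne_zero, not_not,
      ← exists_mulVec_eq_zero_iff]
    -- The all-ones vector is an eigenvector by regularity.
    refine ⟨1, one_ne_zero, ?_⟩
    ext v
    rw [hG.vertexEdgeMatrix_mul_transpose, Algebra.algebraMap_eq_smul_one, sub_mulVec, add_mulVec,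
      smul_mulVec, smul_mulVec, one_mulVec]
    have : (G.adjMatrix ℝ *ᵥ 1) v = d := by
      simpa [mulVec, dotProduct, hG.degree_eq] using G.sum_adjMatrix_row v
    simp [this]
    ring
  rw [hS.spectrum_real_eq_range_eigenvalues] at h
  exact h

theorem IsRegularOfDegree.incidenceEnergy_totalGraph (hG : G.IsRegularOfDegree d) :
    G.totalGraph.incidenceEnergy =
      (Fintype.card V : ℝ) * ((d : ℝ) - 2) * √(2 * (d : ℝ) - 2) / 2 +
        ∑ v, totalContribution d (G.signlessEigenvalues v) := by
  have h := sqrtRootSum_charpoly_total G.vertexEdgeMatrix d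
    G.posSemidef_vertexEdgeMatrix_mul_transpose.isHermitian
    G.posSemidef_vertexEdgeMatrix_mul_transpose.eigenvalues_nonneg
  have hm : 2 * (Fintype.card G.edgeSet : ℝ) = Fintype.card V * d := by
    exact_mod_cast hG.two_mul_card_edgeSet
  have hT : G.totalGraph.vertexEdgeMatrix * G.totalGraph.vertexEdgeMatrixᵀ =
      fromBlocks ((d : ℝ) • 1 + G.vertexEdgeMatrix * G.vertexEdgeMatrixᵀ) G.vertexEdgeMatrix
        G.vertexEdgeMatrixᵀ
        ((2 * (d : ℝ) - 2) • 1 + G.vertexEdgeMatrixᵀ * G.vertexEdgeMatrix) := by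
    rw [hG.totalGraph.vertexEdgeMatrix_mul_transpose, adjMatrix_totalGraph,
      hG.vertexEdgeMatrix_mul_transpose, transpose_mul_vertexEdgeMatrix]
    trans fromBlocks (((2 * d : ℕ) : ℝ) • 1) 0 0 (((2 * d : ℕ) : ℝ) • 1) +
      fromBlocks (G.adjMatrix ℝ) G.vertexEdgeMatrix G.vertexEdgeMatrixᵀ (G.lineGraph.adjMatrix ℝ)
    · congr 1
      ext (i | i) (j | j) <;> simp [one_apply]
    rw [fromBlocks_add]
    congr 1
    · push_cast; module
    · simp
    · simp
    · push_cast; module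
  have hE : G.totalGraph.incidenceEnergy + Fintype.card V * √(2 * (d : ℝ) - 2) =
      Fintype.card G.edgeSet * √(2 * (d : ℝ) - 2) +
        ∑ v, totalContribution d (G.signlessEigenvalues v) := by
    rw [incidenceEnergy_eq_sqrtRootSum, hT]
    convert h
    rfl
  linear_combination hE + √(2 * (d : ℝ) - 2) / 2 * hm

theorem IsRegularOfDegree.incidenceEnergy_totalGraph_lt [Nonempty V] (hG : G.IsRegularOfDegree d)
    (hd : 1 ≤ d) : G.totalGraph.incidenceEnergy <
      (Fintype.card V : ℝ) * ((d : ℝ) - 2) * √(2 * (d : ℝ) - 2) / 2 +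
        2 * (Fintype.card V : ℝ) * √(d : ℝ) +
        ((Fintype.card V : ℝ) - 1) * √(3 * (d : ℝ) - 2) := by
  have hn : (d : ℝ) + 1 ≤ (Fintype.card V : ℝ) := by
    obtain ⟨v⟩ := ‹Nonempty V›
    have := G.degree_lt_card_verts v
    rw [hG.degree_eq] at this
    exact_mod_cast this
  rw [hG.incidenceEnergy_totalGraph, add_assoc]
  gcongr
  exact sum_totalContribution_lt (by exact_mod_cast hd) hn signlessEigenvalues_nonneg
    hG.signlessEigenvalues_le hG.sum_signlessEigenvalues

theorem IsRegularOfDegree.le_incidenceEnergy_totalGraph [Nonempty V] (hG : G.IsRegularOfDegree d)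
    (hd : 1 ≤ d) :
    (Fintype.card V : ℝ) * ((d : ℝ) - 2) * √(2 * (d : ℝ) - 2) / 2 +
        ((Fintype.card V : ℝ) + 1) * √(d : ℝ) + √(3 * (d : ℝ) - 2) +
        ((Fintype.card V : ℝ) - 1) * √(2 * (d : ℝ) - 2) ≤ G.totalGraph.incidenceEnergy ∧
    (G.totalGraph.incidenceEnergy =
      (Fintype.card V : ℝ) * ((d : ℝ) - 2) * √(2 * (d : ℝ) - 2) / 2 +
        ((Fintype.card V : ℝ) + 1) * √(d : ℝ) + √(3 * (d : ℝ) - 2) +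
        ((Fintype.card V : ℝ) - 1) * √(2 * (d : ℝ) - 2) ↔ Fintype.card V = 2) := by
  obtain ⟨v, hv⟩ := hG.exists_signlessEigenvalues_eq
  have hd' : (1 : ℝ) ≤ d := by exact_mod_cast hd
  have h := sum_totalContribution_lower hd' G.signlessEigenvalues_nonneg hv
  rw [hG.incidenceEnergy_totalGraph]
  simp only [add_assoc] at h ⊢
  refine ⟨add_le_add_right h.1 _, ?_⟩
  rw [add_right_inj, h.2, hG.sum_signlessEigenvalues, mul_left_inj' (by positivity)]
  norm_cast

theorem IsRegularOfDegree.exists_iteratedTotalGraph (hG : G.IsRegularOfDegree d) (hd : 1 ≤ d)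
    (k : ℕ) : ∃ r, 1 ≤ r ∧ (G.iteratedTotalGraph k).IsRegularOfDegree r := by
  induction k with
  | zero => exact ⟨d, hd, isRegularOfDegree_congr_locallyFinite _ hG⟩
  | succ k ih =>
    obtain ⟨r, hr, h⟩ := ih
    refine ⟨2 * r, by omega, ?_⟩
    convert! h.totalGraph

instance nonempty_totalIterVert [Nonempty V] (G : SimpleGraph V) (k : ℕ) :
    Nonempty (G.TotalIterVert k) := by
  induction k with
  | zero => exact ‹Nonempty V›
  | succ k ih => exact ih.map Sum.inl

/-- Excludes equality for `k > 0`: the previous iterate has at least two vertices and an edge. -/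
theorem IsRegularOfDegree.two_lt_card_totalIterVert [Nonempty V] (hG : G.IsRegularOfDegree d)
    (hd : 1 ≤ d) (k : ℕ) : 2 < Fintype.card (G.TotalIterVert (k + 1)) := by
  obtain ⟨r, hr, h⟩ := hG.exists_iteratedTotalGraph hd k
  obtain ⟨v⟩ := G.nonempty_totalIterVert k
  have hn := (G.iteratedTotalGraph k).degree_lt_card_verts v
  rw [h.degree_eq] at hn
  have hm := h.two_mul_card_edgeSet
  have hc : Fintype.card (G.TotalIterVert (k + 1)) =
      Fintype.card (G.TotalIterVert k) + Fintype.card (G.iteratedTotalGraph k).edgeSet := by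
    rw [← Fintype.card_sum]
    exact Fintype.card_congr (Equiv.refl _)
  have : 0 < Fintype.card (G.TotalIterVert k) * r := by positivity
  omega

theorem IsRegularOfDegree.nonempty_iso_top_iff (hG : G.IsRegularOfDegree d) (hd : 1 ≤ d) :
    Nonempty (G ≃g (⊤ : SimpleGraph (Fin 2))) ↔ Fintype.card V = 2 := by
  refine ⟨fun ⟨e⟩ => by simpa using Fintype.card_congr e.toEquiv, fun h => ?_⟩
  have htop : G = ⊤ := by
    ext v w
    rw [top_adj]
    refine ⟨fun h => h.ne, fun hvw => ?_⟩
    have hpos : 0 < G.degree v := by rw [hG.degree_eq]; omega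
    obtain ⟨u, hu⟩ := (G.degree_pos_iff_exists_adj v).1 hpos
    by_contra hw
    have huw : u ≠ w := by rintro rfl; exact hw hu
    have : ({v, u, w} : Finset V).card ≤ Fintype.card V := Finset.card_le_univ _
    rw [Finset.card_eq_three.2 ⟨v, u, w, hu.ne, hvw, huw, rfl⟩] at this
    omega
  subst htop
  exact ⟨Iso.completeGraph (Fintype.equivFinOfCardEq h)⟩

end SimpleGraph

open Classical in
theorem corollary3p2 {V : Type*} [Fintype V] [Nonempty V] (G : SimpleGraph V) (r₀ : ℕ)
    (hr₀ : 1 ≤ r₀) (hG : G.IsRegularOfDegree r₀) (k : ℕ) :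
    ∃ r n : ℕ,
      (G.iteratedTotalGraph k).IsRegularOfDegree r ∧
      Fintype.card (G.TotalIterVert k) = n ∧
      (G.iteratedTotalGraph (k + 1)).incidenceEnergy <
        (n : ℝ) * ((r : ℝ) - 2) * √(2 * (r : ℝ) - 2) / 2 + 2 * (n : ℝ) * √(r : ℝ)
          + ((n : ℝ) - 1) * √(3 * (r : ℝ) - 2) ∧
      (G.iteratedTotalGraph (k + 1)).incidenceEnergy ≥
        (n : ℝ) * ((r : ℝ) - 2) * √(2 * (r : ℝ) - 2) / 2 + ((n : ℝ) + 1) * √(r : ℝ)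
          + √(3 * (r : ℝ) - 2) + ((n : ℝ) - 1) * √(2 * (r : ℝ) - 2) ∧
      ((G.iteratedTotalGraph (k + 1)).incidenceEnergy =
        (n : ℝ) * ((r : ℝ) - 2) * √(2 * (r : ℝ) - 2) / 2 + ((n : ℝ) + 1) * √(r : ℝ)
          + √(3 * (r : ℝ) - 2) + ((n : ℝ) - 1) * √(2 * (r : ℝ) - 2) ↔
        Nonempty (G ≃g (⊤ : SimpleGraph (Fin 2))) ∧ k = 0) := by
  obtain ⟨r, hr, h⟩ := hG.exists_iteratedTotalGraph hr₀ k
  have hE : (G.iteratedTotalGraph (k + 1)).incidenceEnergy =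
      (G.iteratedTotalGraph k).totalGraph.incidenceEnergy :=
    SimpleGraph.incidenceEnergy_congr_fintype _ _ _
  have hlow := h.le_incidenceEnergy_totalGraph hr
  have hup := h.incidenceEnergy_totalGraph_lt hr
  rw [← hE] at hlow hup
  refine ⟨r, _, h, rfl, hup, hlow.1, hlow.2.trans ?_⟩
  rw [hG.nonempty_iso_top_iff hr₀]
  rcases k with _ | k
  · have : Fintype.card (G.TotalIterVert 0) = Fintype.card V := Fintype.card_congr (Equiv.refl _)
    simp [this]
  · simpa using (hG.two_lt_card_totalIterVert hr₀ k).ne'
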